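/- Let $\mathbf{F}_q$ be a finite field with $q$ elements ($q$ any prime power, odd or even) and let $n$ be a positive even integer. Let $\mathrm{sym}(m)$ be the number of invertible symmetric $m\times m$ matrices over $\mathbf{F}_q$, let $\mathrm{sym}_0(n)$ be the number of invertible symmetric $n\times n$ matrices over $\mathbf{F}_q$ whose diagonal entries are all zero, and for $0\le k\le n$ let $\mathrm{sym}_0(n,k)$ be the number of invertible symmetric $n\times n$ matrices over $\mathbf{F}_q$ whose first $k$ diagonal entries are zero (with no condition on the other entries). Then $$\mathrm{sym}(n-1)=\mathrm{sym}_0(n),$$ and for every integer $k$ with $0\le k\le n$, $$q^k\,\mathrm{sym}_0(n,k)=\mathrm{sym}_0(n,0)=\mathrm{sym}(n).$$ -/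

import Mathlib

/-- The set of invertible symmetric `n × n` matrices over `F`. -/
def InvSymm (F : Type*) [Field F] (n : ℕ) : Set (Matrix (Fin n) (Fin n) F) :=
  {A | A.IsSymm ∧ IsUnit A}

/-- The set of invertible symmetric `n × n` matrices over `F` whose diagonal is zero. -/
def InvSymmZeroDiag (F : Type*) [Field F] (n : ℕ) : Set (Matrix (Fin n) (Fin n) F) :=
  {A | A.IsSymm ∧ IsUnit A ∧ ∀ i, A i i = 0}

/-- The set of invertible symmetric `n × n` matrices over `F` whose first `k` diagonal
entries are zero (the remaining diagonal entries are arbitrary). -/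
def InvSymmFirstZero (F : Type*) [Field F] (n k : ℕ) : Set (Matrix (Fin n) (Fin n) F) :=
  {A | A.IsSymm ∧ IsUnit A ∧ ∀ i : Fin n, (i : ℕ) < k → A i i = 0}

theorem invSymmFirstZero_zero (F : Type*) [Field F] (n : ℕ) :
    InvSymmFirstZero F n 0 = InvSymm F n := by
  ext A
  simp [InvSymmFirstZero, InvSymm]

theorem invSymmFirstZero_self (F : Type*) [Field F] (n : ℕ) :
    InvSymmFirstZero F n n = InvSymmZeroDiag F n := by
  ext A
  simp [InvSymmFirstZero, InvSymmZeroDiag]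

/-! Border a symmetric block `B` of odd size `m = n - 1` by a corner `x` and a vector `v`. The
determinant is affine in `x` with slope `det B`. If `det B = 0`, invertibility does not depend on
`x`, so freeing `x` multiplies the count by `q`. If `det B ≠ 0`, the singular pairs are those with
`x = v ⬝ᵥ B⁻¹ *ᵥ v`: there are `q ^ m` of them, and those with `x = 0` are the zeros of a
nondegenerate form of odd rank, `q ^ (m - 1)` in number. The ratio is again `q`
(`card_border_eq_card_mul`), and repeating this for `k` diagonal entries gives `q ^ k * sym₀(n, k) =
sym(n)`.

The same bordering, now sorted by `(x, v)`, gives a recursion for `sym`. For `x ≠ 0` a Schur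
complement reduces to size `m`; for `x = 0` and `v ≠ 0`, a congruence moves `v` to a basis vector
and reduces to size `m - 1`. The recursion yields `sym(n) = q ^ n * sym(n - 1)` for even `n > 0`
(`symCount_two_mul`). Comparison with `k = n` and cancellation of `q ^ n` give the first identity.
-/

open Matrix

/-! ### Zeros of quadratic forms of odd rank -/

/-- The two dilates `a x²` and `g a x²`, with `g` a nonsquare, together cover `F` twice. -/
theorem sum_mul_sq_add_sum_nonsquare_mul_sq {F : Type*} [Field F] [Fintype F]
    (hF : ringChar F ≠ 2) {g : F} (hg : ¬ IsSquare g) {a : F} (ha : a ≠ 0) (h : F → ℤ) :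
    ∑ x, h (g * a * x ^ 2) + ∑ x, h (a * x ^ 2) = 2 * ∑ y, h y := by
  classical
  have key : ∀ b : F, b ≠ 0 →
      ∑ x, h (b * x ^ 2) = ∑ y, (quadraticChar F (b * y) + 1) * h y := by
    intro b hb
    rw [← Finset.sum_fiberwise (s := Finset.univ) (g := fun x => b * x ^ 2)]
    refine Finset.sum_congr rfl fun y _ => ?_
    rw [Finset.sum_congr rfl (g := fun _ => h y) (by
      intro x hx; rw [(Finset.mem_filter.1 hx).2]), Finset.sum_const, nsmul_eq_mul]
    congr 1
    -- The fibre over `y` is the set of square roots of `b⁻¹ * y`; as `b` and `b⁻¹` differ by a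
    -- square, its size is `χ(b * y) + 1`.
    have h1 := quadraticChar_card_sqrts hF (b⁻¹ * y)
    have h2 : quadraticChar F (b⁻¹ * y) = quadraticChar F (b * y) := by
      have : b * y = b ^ 2 * (b⁻¹ * y) := by field_simp
      rw [this, map_mul _ (b ^ 2), quadraticChar_sq_one' hb, one_mul]
    rw [← h2, ← h1]
    congr 2
    ext x
    simp only [Finset.mem_filter, Finset.mem_univ, true_and, Set.mem_toFinset, Set.mem_ofPred_eq]
    constructor
    · rintro rfl; field_simp
    · intro hx; rw [hx]; field_simp
  have hg0 : g ≠ 0 := by rintro rfl; exact hg (IsSquare.zero)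
  rw [key _ (mul_ne_zero hg0 ha), key a ha, ← Finset.sum_add_distrib, Finset.mul_sum]
  refine Finset.sum_congr rfl fun y _ => ?_
  rw [mul_assoc, map_mul, quadraticChar_neg_one_iff_not_isSquare.2 hg]
  ring

/-- Number of representations of `s` by the diagonal form with coefficients `w`. -/
def diagRepr {F : Type*} [Field F] [Fintype F] [DecidableEq F] {m : ℕ} (w : Fin m → F) (s : F) :
    ℤ :=
  ∑ x : Fin m → F, if ∑ i, w i * x i ^ 2 = s then 1 else 0

section
variable {F : Type*} [Field F] [Fintype F] [DecidableEq F]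

theorem sum_diagRepr {m : ℕ} (w : Fin m → F) :
    ∑ s, diagRepr w s = (Fintype.card F : ℤ) ^ m := by
  simp only [diagRepr]
  rw [Finset.sum_comm]
  simp

theorem diagRepr_succ {m : ℕ} (w : Fin (m + 1) → F) (s : F) :
    diagRepr w s = ∑ x, diagRepr (fun i => w i.succ) (s - w 0 * x ^ 2) := by
  simp only [diagRepr]
  rw [← (Fin.consEquiv fun _ : Fin (m + 1) => F).sum_comp, Fintype.sum_prod_type]
  refine Finset.sum_congr rfl fun x _ => Finset.sum_congr rfl fun y _ => ?_
  simp [Fin.sum_univ_succ, Fin.consEquiv, eq_sub_iff_add_eq']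

/-- The deviation from the mean `q ^ (m - 1)` is multiplied by `q` to stay integral. Each variable
contributes one sign: averaged over the two dilates of `w 0 * x ^ 2`, the deviation vanishes. -/
theorem diagRepr_nonsquare_mul (hF : ringChar F ≠ 2) {g : F} (hg : ¬ IsSquare g) {m : ℕ}
    (w : Fin m → F) (hw : ∀ i, w i ≠ 0) (s : F) :
    (Fintype.card F : ℤ) * diagRepr (fun i => g * w i) s - (Fintype.card F : ℤ) ^ m =
      (-1) ^ m * ((Fintype.card F : ℤ) * diagRepr w s - (Fintype.card F : ℤ) ^ m) := by
  induction m generalizing s with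
  | zero => simp [diagRepr]
  | succ m ih =>
    have ih' := fun t => ih (fun i => w i.succ) (fun i => hw _) t
    have h1 := sum_mul_sq_add_sum_nonsquare_mul_sq hF hg (hw 0)
      (fun y => diagRepr (fun i => w i.succ) (s - y))
    have h0 : ∑ y, diagRepr (fun i => w i.succ) (s - y) = (Fintype.card F : ℤ) ^ m := by
      rw [← sum_diagRepr fun i => w i.succ]
      exact (Equiv.subLeft s).sum_comp fun y => diagRepr (fun i => w i.succ) y
    rw [h0, ← diagRepr_succ w] at h1
    have h2 : (Fintype.card F : ℤ) * diagRepr (fun i => g * w i) s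
        - (Fintype.card F : ℤ) ^ (m + 1) = ∑ x : F, ((Fintype.card F : ℤ) *
          diagRepr (fun i => g * w i.succ) (s - g * w 0 * x ^ 2) - (Fintype.card F : ℤ) ^ m) := by
      rw [diagRepr_succ, Finset.sum_sub_distrib, Finset.mul_sum]
      simp [pow_succ']
    rw [h2, Finset.sum_congr rfl fun x _ => ih' _, ← Finset.mul_sum, Finset.sum_sub_distrib,
      ← Finset.mul_sum, eq_sub_of_add_eq h1]
    simp [pow_succ']
    ring

/-- Scaling the form by `g` does not change its zeros, so for odd `m` the deviation at `0` equals
its own negative. -/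
theorem diagRepr_zero_of_odd (hF : ringChar F ≠ 2) {m : ℕ} (hm : Odd m)
    (w : Fin m → F) (hw : ∀ i, w i ≠ 0) :
    (Fintype.card F : ℤ) * diagRepr w 0 = (Fintype.card F : ℤ) ^ m := by
  obtain ⟨g, hg⟩ := FiniteField.exists_nonsquare hF
  have hg0 : g ≠ 0 := by rintro rfl; exact hg (IsSquare.zero)
  have h := diagRepr_nonsquare_mul hF hg w hw 0
  have h0 : diagRepr (fun i => g * w i) 0 = diagRepr w 0 := by
    simp only [diagRepr, mul_assoc, ← Finset.mul_sum, mul_eq_zero, hg0, false_or]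
  rw [h0, hm.neg_one_pow] at h
  linarith

end

/-- A nondegenerate quadratic form of odd rank in odd characteristic has `q ^ (m - 1)` zeros. -/
theorem card_isotropic_of_ringChar_ne_two {F m : Type*} [Field F] [Fintype F] [Fintype m]
    [DecidableEq m] (hF : ringChar F ≠ 2) (hm : Odd (Fintype.card m)) (C : Matrix m m F)
    (hC : C.IsSymm) (hdet : C.det ≠ 0) :
    Nat.card F * Nat.card {v : m → F // v ⬝ᵥ C *ᵥ v = 0} = Nat.card F ^ Fintype.card m := by
  classical
  have h2 : (2 : F) ≠ 0 := Ring.two_ne_zero hF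
  let _ : Invertible (2 : F) := invertibleOfNonzero h2
  have hbil : QuadraticMap.associated (R := F) C.toQuadraticForm' = Matrix.toLinearMap₂' F C := by
    refine QuadraticMap.associated_left_inverse (S := F)
      (B₁ := (Matrix.toLinearMap₂' F C : LinearMap.BilinMap F (m → F) F)) fun x y => ?_
    simp only [Matrix.toLinearMap₂'_apply']
    rw [Matrix.dotProduct_mulVec, ← Matrix.mulVec_transpose, hC.eq, dotProduct_comm]
  have hsep : (QuadraticMap.associated (R := F) C.toQuadraticForm').SeparatingLeft := by
    rw [hbil]
    exact (Matrix.nondegenerate_of_det_ne_zero hdet).toLinearMap₂'.1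
  obtain ⟨w, ⟨e⟩⟩ := QuadraticForm.equivalent_weightedSumSquares_units_of_nondegenerate' _ hsep
  have hrank : Module.finrank F (m → F) = Fintype.card m := Module.finrank_fintype_fun_eq_card F
  have h := diagRepr_zero_of_odd hF (by rwa [hrank]) (fun i => (w i : F)) (fun i => (w i).ne_zero)
  have hcard : Nat.card {v : m → F // v ⬝ᵥ C *ᵥ v = 0} =
      Nat.card {x : Fin (Module.finrank F (m → F)) → F // ∑ i, (w i : F) * x i ^ 2 = 0} := by
    refine Nat.card_congr (e.toLinearEquiv.toEquiv.subtypeEquiv fun v => ?_)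
    have := e.map_app v
    rw [QuadraticMap.weightedSumSquares_apply] at this
    have h3 : C.toQuadraticForm' v = v ⬝ᵥ C *ᵥ v := by
      simp [Matrix.toQuadraticForm', Matrix.toLinearMap₂'_apply']
    rw [← h3, ← this]
    simp [Units.smul_def, pow_two]
  rw [hcard, Nat.card_eq_fintype_card, Nat.card_eq_fintype_card, Fintype.card_subtype]
  rw [diagRepr, Finset.sum_boole] at h
  rw [← hrank]
  exact_mod_cast h

/-- In the Leibniz sum the terms of `σ` and `σ⁻¹` are equal and cancel in characteristic two. If `σ
= σ⁻¹`, then `σ` has a fixed point because the index set is odd, and its term contains a zero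
diagonal entry. -/
theorem det_eq_zero_of_odd_alternating {F m : Type*} [Field F] [CharP F 2] [Fintype m]
    [DecidableEq m] (hm : Odd (Fintype.card m)) (C : Matrix m m F)
    (hC : C.IsSymm) (hdiag : ∀ i, C i i = 0) : C.det = 0 := by
  rw [Matrix.det_apply]
  refine Finset.sum_involution (fun σ _ => σ⁻¹) ?_ ?_ (fun _ _ => Finset.mem_univ _) (by simp)
  · intro σ _
    have : ∏ i, C (σ⁻¹ i) i = ∏ i, C (σ i) i := by
      rw [← Equiv.prod_comp σ]
      refine Finset.prod_congr rfl fun i _ => ?_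
      rw [← Equiv.Perm.mul_apply, inv_mul_cancel, Equiv.Perm.one_apply, hC.apply]
    rw [this, Equiv.Perm.sign_inv]
    exact CharTwo.add_self_eq_zero _
  · intro σ _ hne hinv
    apply hne
    obtain ⟨i, hi⟩ := Equiv.Perm.exists_fixed_point_of_prime (p := 2) (n := 1) (σ := σ)
      hm.not_two_dvd_nat (by rw [pow_one, pow_two]; nth_rw 1 [← hinv]; exact inv_mul_cancel σ)
    rw [Finset.prod_eq_zero (Finset.mem_univ i) (by rw [hi, hdiag]), smul_zero]

/-- In characteristic two, `v ↦ v ⬝ᵥ C *ᵥ v` is additive, and surjective when `C` is not alternating. -/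
theorem card_isotropic_of_charTwo {F m : Type*} [Field F] [Finite F] [CharP F 2] [Fintype m]
    [DecidableEq m] (hm : Odd (Fintype.card m)) (C : Matrix m m F)
    (hC : C.IsSymm) (hdet : C.det ≠ 0) :
    Nat.card F * Nat.card {v : m → F // v ⬝ᵥ C *ᵥ v = 0} = Nat.card F ^ Fintype.card m := by
  classical
  obtain ⟨i, hi⟩ : ∃ i, C i i ≠ 0 := by
    by_contra! h
    exact hdet (det_eq_zero_of_odd_alternating hm C hC h)
  let f : (m → F) →+ F :=
    { toFun := fun v => v ⬝ᵥ C *ᵥ v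
      map_zero' := by simp
      map_add' := fun v w => by
        have : w ⬝ᵥ C *ᵥ v = v ⬝ᵥ C *ᵥ w := by
          rw [Matrix.dotProduct_mulVec, ← Matrix.mulVec_transpose, hC.eq, dotProduct_comm]
        rw [Matrix.mulVec_add, add_dotProduct, dotProduct_add, dotProduct_add, this]
        linear_combination CharTwo.add_self_eq_zero (v ⬝ᵥ C *ᵥ w) }
  have hsurj : Function.Surjective f := by
    intro y
    -- Frobenius is bijective on a finite field, so every element has a square root.
    obtain ⟨z, hz⟩ := (Finite.injective_iff_surjective.1 (frobenius_inj F 2)) ((C i i)⁻¹ * y)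
    refine ⟨Pi.single i z, ?_⟩
    rw [frobenius_def] at hz
    change Pi.single i z ⬝ᵥ C *ᵥ Pi.single i z = y
    have : z * (z * C i i) = y := by rw [← mul_assoc, ← pow_two, hz]; field_simp
    simpa using this
  have hker : Nat.card {v : m → F // v ⬝ᵥ C *ᵥ v = 0} = Nat.card f.ker :=
    Nat.card_congr (Equiv.subtypeEquivRight fun v => Iff.rfl)
  have h := AddSubgroup.card_eq_card_quotient_mul_card_addSubgroup f.ker
  rw [Nat.card_congr (QuotientAddGroup.quotientKerEquivOfSurjective f hsurj).toEquiv] at h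
  rw [hker, ← h]
  simp [Nat.card_pi]

theorem card_isotropic_of_odd {F m : Type*} [Field F] [Finite F] [Fintype m]
    [DecidableEq m] (hm : Odd (Fintype.card m)) (C : Matrix m m F)
    (hC : C.IsSymm) (hdet : C.det ≠ 0) :
    Nat.card F * Nat.card {v : m → F // v ⬝ᵥ C *ᵥ v = 0} = Nat.card F ^ Fintype.card m := by
  cases nonempty_fintype F
  by_cases hF : ringChar F = 2
  · have : CharP F 2 := ringChar.of_eq hF
    exact card_isotropic_of_charTwo hm C hC hdet
  · exact card_isotropic_of_ringChar_ne_two hF hm C hC hdet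

/-! ### Bordered matrices and freeing a diagonal entry -/

/-- Invertible symmetric matrices indexed by `m` with zero diagonal entries on `Z`. -/
def InvSymmOn (F : Type*) [Field F] {m : Type*} [Fintype m] [DecidableEq m] (Z : Set m) :
    Set (Matrix m m F) :=
  {A | A.IsSymm ∧ A.det ≠ 0 ∧ ∀ i ∈ Z, A i i = 0}

/-- The symmetric matrix with block `B`, bordered by the row `(x, v)`. -/
def border {F m : Type*} (x : F) (v : m → F) (B : Matrix m m F) :
    Matrix (Unit ⊕ m) (Unit ⊕ m) F :=
  fromBlocks (of fun _ _ => x) (replicateRow Unit v) (replicateCol Unit v) B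

section
variable {F m : Type*}

theorem border_isSymm {x : F} {v : m → F} {B : Matrix m m F} :
    (border x v B).IsSymm ↔ B.IsSymm := by
  rw [border, isSymm_fromBlocks_iff]
  constructor
  · exact fun h => h.2.2.2
  · exact fun h => ⟨rfl, rfl, rfl, h⟩

theorem border_toBlocks {A : Matrix (Unit ⊕ m) (Unit ⊕ m) F} (hA : A.IsSymm) :
    border (A (.inl ()) (.inl ())) (fun j => A (.inl ()) (.inr j)) A.toBlocks₂₂ = A := by
  ext i j
  rcases i with i | i <;> rcases j with j | j <;> simp [border, toBlocks₂₂]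
  exact hA.apply _ _

theorem border_zero_toBlocks [Zero F] {A : Matrix (Unit ⊕ m) (Unit ⊕ m) F} (hA : A.IsSymm)
    (h0 : A (.inl ()) (.inl ()) = 0) :
    border 0 (fun j => A (.inl ()) (.inr j)) A.toBlocks₂₂ = A := by
  rw [← h0, border_toBlocks hA]

variable [Field F] [Fintype m] [DecidableEq m]

theorem det_border (x : F) (v : m → F) (B : Matrix m m F) :
    (border x v B).det = (border 0 v B).det + x * B.det := by
  have h : border x v B = (border 0 v B).updateRow (.inl ())
      (border 0 v B (.inl ()) + x • Pi.single (.inl ()) 1) := by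
    ext i j
    rcases i with i | i <;> rcases j with j | j <;> simp [border]
  have h2 : (border 0 v B).updateRow (.inl ()) (Pi.single (.inl ()) 1) =
      fromBlocks (1 : Matrix Unit Unit F) 0 (replicateCol Unit v) B := by
    ext i j
    rcases i with i | i <;> rcases j with j | j <;> simp [border]
  rw [h, det_updateRow_add, det_updateRow_smul, h2, det_fromBlocks_zero₁₂, updateRow_eq_self]
  simp

theorem det_border_zero (v : m → F) (B : Matrix m m F) (hB : B.det ≠ 0) :
    (border 0 v B).det = -(B.det * (v ⬝ᵥ B⁻¹ *ᵥ v)) := by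
  let _ : Invertible B := invertibleOfIsUnitDet B hB.isUnit
  rw [border, det_fromBlocks₂₂, invOf_eq_nonsing_inv, det_unique (n := Unit)]
  simp [Matrix.mul_assoc, Matrix.mul_apply, dotProduct, mulVec]

theorem det_border_of_ne_zero {x : F} (hx : x ≠ 0) (v : m → F) (B : Matrix m m F) :
    (border x v B).det = x * (B - x⁻¹ • vecMulVec v v).det := by
  have hinv : (of fun _ _ => x : Matrix Unit Unit F) * (of fun _ _ => x⁻¹) = 1 := by
    ext i j; simp [Matrix.mul_apply, hx]
  let _ : Invertible (of fun _ _ => x : Matrix Unit Unit F) := invertibleOfRightInverse _ _ hinv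
  have h : ⅟(of fun _ _ => x : Matrix Unit Unit F) = of fun _ _ => x⁻¹ := rfl
  rw [border, det_fromBlocks₁₁, h, det_unique]
  congr 3
  ext i j
  simp [Matrix.mul_apply, vecMulVec_apply]
  ring

theorem card_invSymmOn_congr {n : Type*} [Fintype n] [DecidableEq n] (e : m ≃ n) (Z : Set n) :
    Nat.card (InvSymmOn F (e ⁻¹' Z)) = Nat.card (InvSymmOn F Z) := by
  refine Nat.card_congr ((Matrix.reindex e e).subtypeEquiv fun A => ?_)
  change _ ↔ _ ∧ _ ∧ _
  rw [Matrix.det_reindex_self]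
  refine and_congr ?_ (and_congr Iff.rfl ?_)
  · constructor
    · intro h; exact h.submatrix _
    · intro h; simpa using h.submatrix e
  · rw [← e.forall_congr_right (q := fun i => i ∈ Z → reindex e e A i i = 0)]
    simp

variable [Finite F]

theorem card_border_eq_card_mul (hm : Odd (Fintype.card m)) (B : Matrix m m F) (hB : B.IsSymm) :
    Nat.card {p : F × (m → F) // (border p.1 p.2 B).det ≠ 0} =
      Nat.card F * Nat.card {v : m → F // (border 0 v B).det ≠ 0} := by
  classical
  cases nonempty_fintype F
  by_cases hdet : B.det = 0
  · rw [← Nat.card_prod]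
    refine Nat.card_congr ⟨fun p => (p.1.1, ⟨p.1.2, ?_⟩), fun p => ⟨(p.1, p.2.1), ?_⟩,
      fun _ => rfl, fun _ => rfl⟩
    · simpa [det_border p.1.1, hdet] using p.2
    · simpa [det_border p.1, hdet] using p.2.2
  · have hiso := card_isotropic_of_odd hm B⁻¹ (by rw [IsSymm, transpose_nonsing_inv, hB.eq])
      (by rw [det_nonsing_inv]; simpa using hdet)
    have h1 : Nat.card {p : F × (m → F) // (border p.1 p.2 B).det = 0} =
        Nat.card F ^ Fintype.card m := by
      have : ∀ p : F × (m → F), (border p.1 p.2 B).det = 0 ↔ p.1 = p.2 ⬝ᵥ B⁻¹ *ᵥ p.2 := by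
        intro p
        rw [det_border, det_border_zero _ _ hdet]
        constructor
        · intro h; apply mul_left_cancel₀ hdet; linear_combination h
        · rintro h; rw [← h]; ring
      rw [Nat.card_congr (Equiv.subtypeEquivRight this),
        Nat.card_congr (β := m → F) ⟨fun p => p.1.2, fun v => ⟨(v ⬝ᵥ B⁻¹ *ᵥ v, v), rfl⟩,
          fun p => Subtype.ext (Prod.ext p.2.symm rfl), fun _ => rfl⟩]
      simp
    have h2 : Nat.card {v : m → F // (border 0 v B).det = 0} =
        Nat.card {v : m → F // v ⬝ᵥ B⁻¹ *ᵥ v = 0} :=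
      Nat.card_congr (Equiv.subtypeEquivRight fun v => by
        rw [det_border_zero _ _ hdet]; simp [hdet])
    rw [← h2] at hiso
    have c1 := Nat.card_congr
      (Equiv.sumCompl fun p : F × (m → F) => (border p.1 p.2 B).det = 0)
    have c2 := Nat.card_congr (Equiv.sumCompl fun v : m → F => (border 0 v B).det = 0)
    rw [Nat.card_sum] at c1 c2
    -- Both totals are now split into singular and invertible parts; the singular parts, `q ^ m` and
    -- `q` times the isotropic count, agree and cancel.
    rw [h1, Nat.card_prod, ← c2, mul_add, hiso] at c1
    exact Nat.add_left_cancel c1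

/-- Freeing one more diagonal entry multiplies the count by `q`, in even dimension. -/
theorem card_invSymmOn_border (hm : Odd (Fintype.card m)) (Z : Set m) :
    Nat.card (InvSymmOn F (Sum.inr '' Z : Set (Unit ⊕ m))) =
      Nat.card F * Nat.card (InvSymmOn F (insert (.inl ()) (Sum.inr '' Z) : Set (Unit ⊕ m))) := by
  classical
  cases nonempty_fintype F
  let S := {B : Matrix m m F // B.IsSymm ∧ ∀ i ∈ Z, B i i = 0}
  have e1 : InvSymmOn F (Sum.inr '' Z : Set (Unit ⊕ m)) ≃
      Σ B : S, {p : F × (m → F) // (border p.1 p.2 B.1).det ≠ 0} :=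
    { toFun := fun A => ⟨⟨A.1.toBlocks₂₂, by
          rw [← border_isSymm, border_toBlocks A.2.1]; exact A.2.1,
          fun i hi => A.2.2.2 _ ⟨i, hi, rfl⟩⟩,
          ⟨(A.1 (.inl ()) (.inl ()), fun j => A.1 (.inl ()) (.inr j)), by
            rw [border_toBlocks A.2.1]; exact A.2.2.1⟩⟩
      invFun := fun p => ⟨border p.2.1.1 p.2.1.2 p.1.1, border_isSymm.2 p.1.2.1, p.2.2, by
        rintro _ ⟨i, hi, rfl⟩; exact p.1.2.2 i hi⟩
      left_inv := fun A => Subtype.ext (border_toBlocks A.2.1)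
      right_inv := fun _ => rfl }
  have e2 : InvSymmOn F (insert (.inl ()) (Sum.inr '' Z) : Set (Unit ⊕ m)) ≃
      Σ B : S, {v : m → F // (border 0 v B.1).det ≠ 0} :=
    { toFun := fun A => ⟨⟨A.1.toBlocks₂₂, by
          rw [← border_isSymm, border_toBlocks A.2.1]; exact A.2.1,
          fun i hi => A.2.2.2 _ (.inr ⟨i, hi, rfl⟩)⟩,
          ⟨fun j => A.1 (.inl ()) (.inr j), by
            rw [border_zero_toBlocks A.2.1 (A.2.2.2 _ (.inl rfl))]; exact A.2.2.1⟩⟩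
      invFun := fun p => ⟨border 0 p.2.1 p.1.1, border_isSymm.2 p.1.2.1, p.2.2, by
        rintro _ (rfl | ⟨i, hi, rfl⟩)
        · rfl
        · exact p.1.2.2 i hi⟩
      left_inv := fun A => Subtype.ext (border_zero_toBlocks A.2.1 (A.2.2.2 _ (.inl rfl)))
      right_inv := fun _ => rfl }
  rw [Nat.card_congr e1, Nat.card_congr e2, Nat.card_sigma, Nat.card_sigma, Finset.mul_sum]
  exact Finset.sum_congr rfl fun B _ => card_border_eq_card_mul hm B.1 B.2.1

theorem card_invSymmOn_insert (hm : Even (Fintype.card m)) (Z : Set m) (i : m) (hi : i ∉ Z) :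
    Nat.card (InvSymmOn F Z) = Nat.card F * Nat.card (InvSymmOn F (insert i Z)) := by
  classical
  let e : Unit ⊕ {j // j ≠ i} ≃ m :=
    ((Equiv.sumComm _ _).trans (Equiv.optionEquivSumPUnit _).symm).trans (Equiv.optionSubtypeNe i)
  have hl : e (.inl ()) = i := by simp [e]
  have hr : ∀ j, e (.inr j) = j.1 := by intro j; simp [e]
  have h1 : e ⁻¹' Z = Sum.inr '' {j : {j // j ≠ i} | j.1 ∈ Z} := by
    ext (j | j)
    · simp [hl, hi]
    · simp [hr]
  have h2 : e ⁻¹' (insert i Z) = insert (.inl ()) (Sum.inr '' {j : {j // j ≠ i} | j.1 ∈ Z}) := by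
    ext (j | j)
    · simp [hl]
    · simp [hr, j.2]
  have hodd : Odd (Fintype.card {j // j ≠ i}) := by
    have := Fintype.card_congr e
    rw [Fintype.card_sum, Fintype.card_unit] at this
    rw [← this, Nat.even_add] at hm
    simpa using hm
  rw [← card_invSymmOn_congr e, ← card_invSymmOn_congr e (insert i Z), h1, h2,
    card_invSymmOn_border hodd]

end

/-! ### Counting symmetric matrices by first row -/

/-- Symmetric blocks `B` whose border by `(x, v)` is invertible. -/
def BorderFiber {F m : Type*} [Field F] [Fintype m] [DecidableEq m] (x : F) (v : m → F) :
    Set (Matrix m m F) :=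
  {B | B.IsSymm ∧ (border x v B).det ≠ 0}

theorem isSymm_smul_vecMulVec {F m : Type*} [Field F] (x : F) (v : m → F) : (x • vecMulVec v v).IsSymm := by
  ext i j
  simp [vecMulVec_apply, mul_comm]

section
variable {F m : Type*} [Field F] [Fintype m] [DecidableEq m]

/-- Translation by the symmetric matrix `x⁻¹ • vecMulVec v v` turns `B` into the Schur complement of
the corner. -/
theorem card_borderFiber_of_ne_zero {x : F} (hx : x ≠ 0) (v : m → F) :
    Nat.card (BorderFiber x v) = Nat.card (InvSymmOn F (∅ : Set m)) := by
  refine Nat.card_congr ((Equiv.subRight (x⁻¹ • vecMulVec v v)).subtypeEquiv fun B => ?_)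
  change _ ∧ _ ↔ _ ∧ _ ∧ _
  rw [det_border_of_ne_zero hx]
  have := isSymm_smul_vecMulVec x⁻¹ v
  simp only [Equiv.subRight_apply, Set.mem_empty_iff_false, false_implies, implies_true, and_true,
    ne_eq, mul_eq_zero, hx, false_or]
  refine and_congr_left fun _ => ⟨fun h => h.sub this, fun h => ?_⟩
  simpa using h.add this

theorem card_borderFiber_zero : Nat.card (BorderFiber (0 : F) (0 : m → F)) = 0 := by
  rw [Nat.card_eq_zero]
  left
  refine ⟨fun B => B.2.2 (det_eq_zero_of_row_eq_zero (.inl ()) fun j => ?_)⟩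
  rcases j with j | j <;> simp [border]

/-- Congruence by the block matrix `diag(1, P)` preserves symmetry and invertibility and sends `v`
to `P *ᵥ v`. -/
theorem card_borderFiber_mulVec (P : Matrix m m F) (hP : P.det ≠ 0) (v : m → F) :
    Nat.card (BorderFiber (0 : F) (P *ᵥ v)) = Nat.card (BorderFiber (0 : F) v) := by
  have hu : IsUnit P.det := hP.isUnit
  have hut : IsUnit Pᵀ.det := by rwa [det_transpose]
  let e : Matrix m m F ≃ Matrix m m F :=
    { toFun := fun B => P * B * Pᵀ
      invFun := fun B => P⁻¹ * B * Pᵀ⁻¹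
      left_inv := fun B => by
        simp only [Matrix.mul_assoc]
        rw [mul_nonsing_inv _ hut, Matrix.mul_one, ← Matrix.mul_assoc, nonsing_inv_mul _ hu,
          Matrix.one_mul]
      right_inv := fun B => by
        simp only [Matrix.mul_assoc]
        rw [nonsing_inv_mul _ hut, Matrix.mul_one, ← Matrix.mul_assoc, mul_nonsing_inv _ hu,
          Matrix.one_mul] }
  refine (Nat.card_congr (e.subtypeEquiv fun B => ?_)).symm
  change _ ∧ _ ↔ _ ∧ _
  refine and_congr ?_ ?_
  · constructor
    · intro h
      simp [e, IsSymm, transpose_mul, h.eq, Matrix.mul_assoc]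
    · intro h
      rw [← e.symm_apply_apply B]
      change (P⁻¹ * e B * Pᵀ⁻¹).IsSymm
      simp [IsSymm, transpose_mul, h.eq, Matrix.mul_assoc, transpose_nonsing_inv]
  · have h : border 0 (P *ᵥ v) (e B) =
        fromBlocks (1 : Matrix Unit Unit F) 0 0 P * border 0 v B * fromBlocks 1 0 0 Pᵀ := by
      rw [border, border, fromBlocks_multiply, fromBlocks_multiply]
      congr 1
      · ext; simp
      · ext; simp [Matrix.mul_apply, mulVec, dotProduct, mul_comm]
      · ext; simp [Matrix.mul_apply, mulVec, dotProduct]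
      · simp [e]
    rw [h, det_mul, det_mul, det_fromBlocks_zero₁₂, det_fromBlocks_zero₁₂]
    simp [hP]

theorem exists_det_ne_zero_mulVec_single (i : m) (v : m → F) (hv : v ≠ 0) :
    ∃ P : Matrix m m F, P.det ≠ 0 ∧ P *ᵥ Pi.single i 1 = v := by
  obtain ⟨j, hj⟩ := Function.ne_iff.1 hv
  -- Putting `v` in column `j` of the identity gives determinant `v j ≠ 0`; swapping columns `i` and
  -- `j` then makes `v` the image of the `i`-th basis vector.
  refine ⟨((1 : Matrix m m F).updateCol j v).submatrix id (Equiv.swap j i), ?_, ?_⟩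
  · rw [det_permute', ← cramer_apply, cramer_one]
    rcases Int.units_eq_one_or (Equiv.swap j i).sign with h | h <;> simpa [h] using hj
  · ext k
    simp

/-- The kernels correspond: the first row kills the second coordinate, the second row determines the
first coordinate, and the remaining coordinates form a kernel vector of `B`. Hence `y` and `w` are
free. -/
theorem det_border_zero_single (y : F) (w : m → F) (B : Matrix m m F) :
    (border 0 (Pi.single (.inl ()) 1) (border y w B)).det ≠ 0 ↔ B.det ≠ 0 := by
  rw [not_iff_not, ← exists_mulVec_eq_zero_iff, ← exists_mulVec_eq_zero_iff]
  constructor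
  · rintro ⟨u, hu, h⟩
    have h0 : u (.inr (.inl ())) = 0 := by
      simpa [border, mulVec, dotProduct, Pi.single_apply] using congrFun h (.inl ())
    have h1 : u (.inl ()) + ∑ j, w j * u (.inr (.inr j)) = 0 := by
      simpa [border, mulVec, dotProduct, Pi.single_apply, h0] using congrFun h (.inr (.inl ()))
    have h2 : ∀ i, ∑ j, B i j * u (.inr (.inr j)) = 0 := fun i => by
      simpa [border, mulVec, dotProduct, Pi.single_apply, h0] using congrFun h (.inr (.inr i))
    refine ⟨fun j => u (.inr (.inr j)), fun h3 => hu ?_, funext h2⟩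
    have h3' : ∀ j, u (.inr (.inr j)) = 0 := congrFun h3
    ext (j | j | j)
    · simpa [h3'] using h1
    · exact h0
    · exact h3' j
  · rintro ⟨c, hc, h⟩
    have h' : ∀ i, ∑ j, B i j * c j = 0 := congrFun h
    refine ⟨Sum.elim (fun _ => -∑ j, w j * c j) (Sum.elim 0 c), fun h0 => hc ?_, ?_⟩
    · ext j
      simpa using congrFun h0 (.inr (.inr j))
    · ext (i | i | i) <;> simp [border, mulVec, dotProduct, Pi.single_apply, h']

theorem card_borderFiber_single :
    Nat.card (BorderFiber (0 : F) (Pi.single (.inl ()) 1 : Unit ⊕ m → F)) =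
      Nat.card F ^ (Fintype.card m + 1) * Nat.card (InvSymmOn F (∅ : Set m)) := by
  have e : BorderFiber (0 : F) (Pi.single (.inl ()) 1 : Unit ⊕ m → F) ≃
      (F × (m → F)) × InvSymmOn F (∅ : Set m) :=
    { toFun := fun B => ((B.1 (.inl ()) (.inl ()), fun j => B.1 (.inl ()) (.inr j)),
        ⟨B.1.toBlocks₂₂, by rw [← border_isSymm, border_toBlocks B.2.1]; exact B.2.1, by
          rw [← det_border_zero_single, border_toBlocks B.2.1]; exact B.2.2, by simp⟩)
      invFun := fun p => ⟨border p.1.1 p.1.2 p.2.1, border_isSymm.2 p.2.2.1,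
        (det_border_zero_single _ _ _).2 p.2.2.2.1⟩
      left_inv := fun B => Subtype.ext (border_toBlocks B.2.1)
      right_inv := fun _ => rfl }
  rw [Nat.card_congr e, Nat.card_prod, Nat.card_prod]
  have h : Nat.card (m → F) = Nat.card F ^ Fintype.card m := by simp [Nat.card_fun]
  rw [h, pow_succ']

variable [Finite F]

theorem card_invSymmOn_eq_sum [Fintype F] :
    Nat.card (InvSymmOn F (∅ : Set (Unit ⊕ m))) =
      ∑ x : F, ∑ v : m → F, Nat.card (BorderFiber x v) := by
  have e : InvSymmOn F (∅ : Set (Unit ⊕ m)) ≃ Σ p : F × (m → F), BorderFiber p.1 p.2 :=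
    { toFun := fun A => ⟨(A.1 (.inl ()) (.inl ()), fun j => A.1 (.inl ()) (.inr j)),
        ⟨A.1.toBlocks₂₂, by rw [← border_isSymm, border_toBlocks A.2.1]; exact A.2.1, by
          rw [border_toBlocks A.2.1]; exact A.2.2.1⟩⟩
      invFun := fun p => ⟨border p.1.1 p.1.2 p.2.1, border_isSymm.2 p.2.2.1, p.2.2.2, by simp⟩
      left_inv := fun A => Subtype.ext (border_toBlocks A.2.1)
      right_inv := fun _ => rfl }
  classical
  rw [Nat.card_congr e, Nat.card_sigma, Fintype.sum_prod_type]

theorem card_invSymmOn_border_empty {c : ℕ}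
    (hc : ∀ v : m → F, v ≠ 0 → Nat.card (BorderFiber (0 : F) v) = c) :
    Nat.card (InvSymmOn F (∅ : Set (Unit ⊕ m))) =
      (Nat.card F - 1) * Nat.card F ^ Fintype.card m * Nat.card (InvSymmOn F (∅ : Set m)) +
        (Nat.card F ^ Fintype.card m - 1) * c := by
  classical
  cases nonempty_fintype F
  rw [card_invSymmOn_eq_sum, ← Finset.sum_erase_add _ _ (Finset.mem_univ (0 : F))]
  congr 1
  · rw [Finset.sum_congr rfl fun x hx => Finset.sum_congr rfl fun v _ =>
      card_borderFiber_of_ne_zero (Finset.ne_of_mem_erase hx) v]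
    simp [Finset.card_erase_of_mem, mul_assoc]
  · rw [← Finset.sum_erase_add _ _ (Finset.mem_univ (0 : m → F)), card_borderFiber_zero,
      Finset.sum_congr rfl fun v hv => hc v (Finset.ne_of_mem_erase hv)]
    simp [Finset.card_erase_of_mem]

end

/-! ### Solving the recursion for `sym` -/

/-- `sym(m)`, the number of invertible symmetric `m × m` matrices. -/
noncomputable def symCount (F : Type*) [Field F] (m : ℕ) : ℕ := (InvSymm F m).ncard

section
variable (F : Type*) [Field F]

theorem symCount_eq_card_invSymmOn {m : ℕ} {n : Type*} [Fintype n] [DecidableEq n]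
    (h : Fintype.card n = m) : symCount F m = Nat.card (InvSymmOn F (∅ : Set n)) := by
  have e : n ≃ Fin m := Fintype.equivFinOfCardEq h
  have h1 := card_invSymmOn_congr (F := F) e ∅
  rw [Set.preimage_empty] at h1
  rw [h1]
  change Nat.card (InvSymm F m) = _
  congr 2
  ext A
  simp [InvSymm, InvSymmOn, isUnit_iff_isUnit_det]

theorem symCount_zero : symCount F 0 = 1 := by
  have h : InvSymm F 0 = Set.univ := by
    ext A
    simp [InvSymm, IsSymm, eq_iff_true_of_subsingleton]
  rw [symCount, h, Set.ncard_univ]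
  simp

variable [Finite F]

theorem symCount_one : symCount F 1 = Nat.card F - 1 := by
  -- There is no nonzero `v` in dimension `0`, so the value of `c` is immaterial.
  have h := card_invSymmOn_border_empty (F := F) (m := Fin 0) (c := 0)
    (fun v hv => absurd (Subsingleton.elim v 0) hv)
  rw [← symCount_eq_card_invSymmOn F (m := 1) (by simp),
    ← symCount_eq_card_invSymmOn F (m := 0) (by simp), symCount_zero] at h
  simpa using h

theorem symCount_add_two (m : ℕ) :
    symCount F (m + 2) = (Nat.card F - 1) * Nat.card F ^ (m + 1) * symCount F (m + 1) +
      (Nat.card F ^ (m + 1) - 1) * (Nat.card F ^ (m + 1) * symCount F m) := by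
  have h := card_invSymmOn_border_empty (F := F) (m := Unit ⊕ Fin m)
    (c := Nat.card F ^ (m + 1) * symCount F m) fun v hv => by
      obtain ⟨P, hP, rfl⟩ := exists_det_ne_zero_mulVec_single (.inl ()) v hv
      rw [card_borderFiber_mulVec P hP, card_borderFiber_single,
        ← symCount_eq_card_invSymmOn F (m := m) (by simp)]
      simp
  rw [← symCount_eq_card_invSymmOn F (m := m + 2) (by simp; ring),
    ← symCount_eq_card_invSymmOn F (m := m + 1) (by simp; ring)] at h
  simpa [add_comm] using h

/-- The two relations feed each other: each turns the second term of the recursion into a multiple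
of the larger count in the first term, leaving the factor `q ^ (2 * j + 2)` or `q ^ (2 * j + 3) -
1`. -/
theorem symCount_two_mul (j : ℕ) :
    symCount F (2 * j + 1) = (Nat.card F ^ (2 * j + 1) - 1) * symCount F (2 * j) ∧
      symCount F (2 * j + 2) = Nat.card F ^ (2 * j + 2) * symCount F (2 * j + 1) := by
  have hstep : ∀ j, symCount F (2 * j + 1) = (Nat.card F ^ (2 * j + 1) - 1) * symCount F (2 * j) →
      symCount F (2 * j + 2) = Nat.card F ^ (2 * j + 2) * symCount F (2 * j + 1) := by
    intro j h
    -- Writing `q = p + 1` removes the truncated subtraction `q - 1`.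
    obtain ⟨p, hp⟩ := Nat.exists_eq_add_of_lt (Nat.card_pos (α := F))
    rw [symCount_add_two, mul_left_comm, ← h, hp]
    simp
    ring
  have hodd : symCount F (2 * j + 1) = (Nat.card F ^ (2 * j + 1) - 1) * symCount F (2 * j) := by
    induction j with
    | zero => simp [symCount_one, symCount_zero]
    | succ j ih =>
      have h2 := hstep j ih
      have h1 : 1 ≤ Nat.card F ^ (2 * j + 2) := Nat.one_le_pow _ _ Nat.card_pos
      have h3 : 1 ≤ Nat.card F ^ (2 * j + 3) := Nat.one_le_pow _ _ Nat.card_pos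
      change symCount F (2 * j + 1 + 2) = (Nat.card F ^ (2 * j + 3) - 1) * symCount F (2 * j + 2)
      rw [symCount_add_two]
      change _ * _ * symCount F (2 * j + 2) + (Nat.card F ^ (2 * j + 2) - 1) *
        (Nat.card F ^ (2 * j + 2) * _) = _
      rw [← h2, ← add_mul]
      congr 1
      zify [h1, h3, Nat.card_pos (α := F)]
      ring
  exact ⟨hodd, hstep j hodd⟩

end

/-! ### Conclusion -/

theorem mainTheorem3 (F : Type*) [Field F] [Finite F] (n : ℕ) (hpos : 0 < n) (hn : Even n) :
    (InvSymm F (n - 1)).ncard = (InvSymmZeroDiag F n).ncard ∧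
      ∀ k : ℕ, k ≤ n →
        Nat.card F ^ k * (InvSymmFirstZero F n k).ncard = (InvSymmFirstZero F n 0).ncard ∧
          Nat.card F ^ k * (InvSymmFirstZero F n k).ncard = (InvSymm F n).ncard := by
  have hset : ∀ k, InvSymmFirstZero F n k = InvSymmOn F {i : Fin n | (i : ℕ) < k} := by
    intro k
    ext A
    simp [InvSymmFirstZero, InvSymmOn, isUnit_iff_isUnit_det]
  have hmain : ∀ k ≤ n, Nat.card F ^ k * (InvSymmFirstZero F n k).ncard = (InvSymm F n).ncard := by
    intro k hk
    induction k with
    | zero => rw [invSymmFirstZero_zero, pow_zero, one_mul]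
    | succ k ih =>
      rw [← ih (by omega), pow_succ, mul_assoc, hset, hset]
      congr 1
      have h := card_invSymmOn_insert (F := F) (m := Fin n) (by simpa using hn)
        {i : Fin n | (i : ℕ) < k} ⟨k, hk⟩ (by simp)
      have h2 : insert (⟨k, hk⟩ : Fin n) {i : Fin n | (i : ℕ) < k} =
          {i : Fin n | (i : ℕ) < k + 1} := by
        ext i
        simp only [Set.mem_insert_iff, Set.mem_ofPred_eq, Fin.ext_iff]
        omega
      rw [h2] at h
      exact h.symm
  refine ⟨?_, fun k hk => ⟨by rw [invSymmFirstZero_zero, hmain k hk], hmain k hk⟩⟩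
  obtain ⟨j, rfl⟩ : ∃ j, n = 2 * j + 2 := by
    obtain ⟨r, rfl⟩ := hn
    exact ⟨r - 1, by omega⟩
  have h1 := hmain _ le_rfl
  rw [invSymmFirstZero_self] at h1
  have h2 := (symCount_two_mul F j).2
  -- Both counts become `sym(n)` after multiplication by `q ^ n`, which is positive.
  exact Nat.eq_of_mul_eq_mul_left (Nat.pow_pos Nat.card_pos) (h2.symm.trans h1.symm)
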